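/- Let $c_j=(-1)^{j-1}\left(j+\frac{1+(-1)^j}{2}\right)$ for $j\ge 0$ and $a_j=-j^2\,(2-(-1)^j)$ for $j\ge1$, and let $Q_k$ be the denominator polynomials of the convergents of the Jacobi fraction $$\cfrac{1}{1-c_0z-\cfrac{a_1z^2}{1-c_1z-\cfrac{a_2z^2}{\ddots}}},$$ that is, $Q_0=1$, $Q_1=1-c_0z$ and $Q_k=(1-c_{k-1}z)Q_{k-1}-a_{k-1}z^2Q_{k-2}$ for $k\ge2$. Let $q_k(z)=z^kQ_k(1/z)$ be the reciprocal polynomials, and let $$\Upsilon(z,t):=\sum_{k=0}^\infty q_k(z)\frac{t^k}{k!}.$$ Consider the algebraic curve $$2+3t+3t(1+t)\,\eta-2(1-3t^2+3t^4)\,\eta^3=0 .$$ It is of genus $0$ and is (birationally) parametrized by $$t=\frac13\,\frac{(w^2+3)w}{w^2+1},\qquad \eta=3\,\frac{(w+1)(w^2+1)}{w^4+3}.$$ There is exactly one germ at $t=0$ of an analytic branch $\eta(t)$ of the curve with $\eta(0)=1$, and $$\eta(t)=1+t+2\frac{t^2}{2!}+10\frac{t^3}{3!}+24\frac{t^4}{4!}+280\frac{t^5}{5!}+400\frac{t^6}{6!}+12880\frac{t^7}{7!}+O(t^8).$$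 Define, for $t$ near $0$ and with the square roots that equal $1$ at the origin, $$\chi(t):=\sqrt{\eta(t)^2-\frac{2t(1+t)}{1-3t^2+3t^4}},\qquad J(t):=\int_0^t\frac{du}{\sqrt{1-3u^2+3u^4}} .$$ These are analytic at $0$, with $$\chi(t)=1+\frac{t^2}{2!}-2\frac{t^3}{3!}+\frac{t^4}{4!}-100\frac{t^5}{5!}-575\frac{t^6}{6!}+O(t^7),$$ $$J(t)=t+3\frac{t^3}{3!}+45\frac{t^5}{5!}+1215\frac{t^7}{7!}+8505\frac{t^9}{9!}+O(t^{10}).$$ Then there is a neighbourhood of $t=0$ in $\mathbb{C}$ such that, for every $t$ in it and every $z\in\mathbb{C}$, the series $\Upsilon(z,t)$ converges and $$\Upsilon(z,t)=\eta(t)\cosh\left(zJ(t)\right)+\chi(t)\sinh\left(zJ(t)\right).$$ -/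

import Mathlib

open scoped Topology Polynomial

noncomputable section

/-! ### The Jacobi fraction `1/(1 - c₀z - a₁z²/(1 - c₁z - a₂z²/⋱))` and its denominators -/

/-- The coefficients `c_j = (-1)^(j-1) (j + (1 + (-1)^j)/2)`, i.e. `-1, 1, -3, 3, -5, 5, …`. -/
def jCoeffC (j : ℕ) : ℂ := (-1) ^ (j + 1) * ((j : ℂ) + (1 + (-1) ^ j) / 2)

/-- The coefficients `a_j = -j² (2 - (-1)^j)`, i.e. (from `j = 1`) `-3·1², -2², -3·3², -4², …`. -/
def jCoeffA (j : ℕ) : ℂ := -(j : ℂ) ^ 2 * (2 - (-1) ^ j)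

/-- The denominators `Q_k` of the convergents of the Jacobi fraction with coefficients `c`, `a`:
`Q₋₁ = 0`, `Q₀ = 1`, `Q_k = (1 - c_{k-1} z) Q_{k-1} - a_{k-1} z² Q_{k-2}`. -/
def jDenom (c a : ℕ → ℂ) : ℕ → ℂ[X]
  | 0 => 1
  | 1 => 1 - Polynomial.C (c 0) * Polynomial.X
  | k + 2 => (1 - Polynomial.C (c (k + 1)) * Polynomial.X) * jDenom c a (k + 1)
      - Polynomial.C (a (k + 1)) * Polynomial.X ^ 2 * jDenom c a k

/-- The reciprocal polynomials `q_k(z) = z^k Q_k(1/z)`. -/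
def recipDenom (k : ℕ) : ℂ[X] := Polynomial.reflect k (jDenom jCoeffC jCoeffA k)

theorem natDegree_jDenom_le (c a : ℕ → ℂ) : ∀ k, (jDenom c a k).natDegree ≤ k
  | 0 => by simp [jDenom]
  | 1 => by
      unfold jDenom
      compute_degree
  | k + 2 => by
      have h1 := natDegree_jDenom_le c a (k + 1)
      have h0 := natDegree_jDenom_le c a k
      unfold jDenom
      refine (Polynomial.natDegree_sub_le _ _).trans (max_le ?_ ?_)
      · refine Polynomial.natDegree_mul_le.trans ?_
        have : (1 - Polynomial.C (c (k + 1)) * Polynomial.X : ℂ[X]).natDegree ≤ 1 := by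
          compute_degree
        omega
      · refine Polynomial.natDegree_mul_le.trans ?_
        have : (Polynomial.C (a (k + 1)) * Polynomial.X ^ 2 : ℂ[X]).natDegree ≤ 2 := by
          compute_degree
        omega

theorem eval_recipDenom (k : ℕ) (z : ℂ) (hz : z ≠ 0) :
    (recipDenom k).eval z = z ^ k * (jDenom jCoeffC jCoeffA k).eval z⁻¹ := by
  have : Invertible z⁻¹ := invertibleOfNonzero (inv_ne_zero hz)
  have h := Polynomial.eval₂_reflect_mul_pow (RingHom.id ℂ) z⁻¹ k
    (jDenom jCoeffC jCoeffA k) (natDegree_jDenom_le _ _ k)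
  rw [invOf_eq_inv, inv_inv] at h
  change (recipDenom k).eval z * _ = (jDenom jCoeffC jCoeffA k).eval z⁻¹ at h
  rw [← h, inv_pow]
  field_simp

/-! ### Function field, genus and parametrization of a plane algebraic curve over `ℂ` -/

/-- `K` is the function field over `ℂ` of the irreducible affine plane curve `F = 0`, with `x` and
`y` as coordinate functions: the polynomial relations between `x` and `y` are exactly the multiples
of `F`, and `x`, `y` generate `K` as a field. -/
def IsFunctionFieldOf {K : Type} [Field K] [Algebra ℂ K]
    (F : MvPolynomial (Fin 2) ℂ) (x y : K) : Prop :=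
  RingHom.ker (MvPolynomial.aeval (R := ℂ) ![x, y]) = Ideal.span {F} ∧
    IntermediateField.adjoin ℂ {x, y} = ⊤

/-- The everywhere regular (Kähler) differentials of a function field `K` over `ℂ`: those `ω` that,
for every valuation ring `O` of `K` containing `ℂ`, lie in the `O`-module generated by the
differentials `dx` with `x ∈ O`. -/
def regularDifferentials (K : Type) [Field K] [Algebra ℂ K] : Submodule ℂ (Ω[K⁄ℂ]) where
  carrier := {ω | ∀ O : ValuationSubring K, (∀ c : ℂ, algebraMap ℂ K c ∈ O) →
    ω ∈ Submodule.span O.toSubring (KaehlerDifferential.D ℂ K '' (O : Set K))}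
  add_mem' := fun ha hb O hO => Submodule.add_mem _ (ha O hO) (hb O hO)
  zero_mem' := fun _ _ => Submodule.zero_mem _
  smul_mem' := fun c ω hω O hO => by
    have h := Submodule.smul_mem _ (⟨algebraMap ℂ K c, hO c⟩ : O.toSubring) (hω O hO)
    have e : (⟨algebraMap ℂ K c, hO c⟩ : O.toSubring) • ω = c • ω :=
      algebraMap_smul K c ω
    rwa [e] at h

/-- The irreducible plane curve `F = 0` over `ℂ` has (geometric) genus `g`: the regular
differentials of its function field form a complex vector space of dimension `g`. -/
def PlaneCurveHasGenus (F : MvPolynomial (Fin 2) ℂ) (g : ℕ) : Prop :=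
  ∃ (K : Type) (_ : Field K) (_ : Algebra ℂ K) (x y : K),
    IsFunctionFieldOf F x y ∧ Module.rank ℂ (regularDifferentials K) = g

/-- The rational functions `x(w)`, `y(w)` parametrize the irreducible plane curve `F = 0`
(birationally): they realize the field `ℂ(w)` as its function field. -/
def IsRationalParametrization (F : MvPolynomial (Fin 2) ℂ) (x y : RatFunc ℂ) : Prop :=
  IsFunctionFieldOf F x y

/-! ### The objects of the generating function -/

/-- The cubic curve `2 + 3t + 3t(1+t)η - 2(1 - 3t² + 3t⁴)η³ = 0`, with `t = X 0`, `η = X 1`. -/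
def etaCurve : MvPolynomial (Fin 2) ℂ :=
  let t : MvPolynomial (Fin 2) ℂ := MvPolynomial.X 0
  let η : MvPolynomial (Fin 2) ℂ := MvPolynomial.X 1
  2 + 3 * t + 3 * t * (1 + t) * η - 2 * (1 - 3 * t ^ 2 + 3 * t ^ 4) * η ^ 3

/-- `η` is (a representative of the germ at `0` of) an analytic branch of the cubic curve with
`η(0) = 1`. -/
def IsEtaBranch (η : ℂ → ℂ) : Prop :=
  AnalyticAt ℂ η 0 ∧ η 0 = 1 ∧ ∀ᶠ t in 𝓝 (0 : ℂ), MvPolynomial.eval ![t, η t] etaCurve = 0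

/-- `χ(t) = √(η(t)² - 2t(1+t)/(1 - 3t² + 3t⁴))`, with the principal square root
(the radicand is `1` at `t = 0`). -/
def chiOf (η : ℂ → ℂ) (t : ℂ) : ℂ :=
  (η t ^ 2 - 2 * t * (1 + t) / (1 - 3 * t ^ 2 + 3 * t ^ 4)) ^ (1 / 2 : ℂ)

/-- `J(t) = ∫_0^t du / √(1 - 3u² + 3u⁴)`, along the segment `u = s t`, `0 ≤ s ≤ 1`, with the
principal square root. -/
def ellipticJ (t : ℂ) : ℂ :=
  ∫ s in (0 : ℝ)..1, t / (1 - 3 * ((s : ℂ) * t) ^ 2 + 3 * ((s : ℂ) * t) ^ 4) ^ (1 / 2 : ℂ)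

/-- The derivatives `g(0), g'(0), g''(0), …` of `g` at `0` start with the list `l`, i.e.
`g(t) = l₀ + l₁ t + l₂ t²/2! + l₃ t³/3! + ⋯`. -/
def EgfCoeffsStartWith (g : ℂ → ℂ) (l : List ℂ) : Prop :=
  ∀ k (hk : k < l.length), iteratedDeriv k g 0 = l[k]

end

/-! ### Function fields of plane curves through bivariate polynomials -/

/-! For the even and odd parts `E`, `O` of `Υ` in `t`, the three-term recurrence of `q_k` becomes a
linear system A (O', E') = z (E, O) + (E + tO, 3tE), where A has rows (1 - t², -t) and (t, 1 - 3t²)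
and determinant P = 1 - 3t² + 3t⁴. Conversely, a solution with E(0) = 1, O(0) = 0 has the `q_k(z)`
as Taylor coefficients of `E + O` (`iteratedDeriv_system_eq_recipDenom`).

For z = 0 a solution (o, e) is read off the parametrization: e + o = η, checked by differentiating
in `w` (`hasDerivAt_eta_system`). Put S = √P. The matrix A followed by the exchange of the two
coordinates is traceless with square P, so its quotient by S is an involution. It sends (o, e) to
(x, y) with (x + y)² = χ² (`chi_sq`), and (x, y) again solves the system for z = 0
(`hasDerivAt_chi_system`). Since J' = 1/S, the functions E = e cosh(zJ) + y sinh(zJ) and O = o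
cosh(zJ) + x sinh(zJ) solve it for every z (`hasDerivAt_hyperbolic_system`). They are holomorphic on
a ball that does not depend on z, so their Taylor series converge there (`SolvesSystem.hasSum`).

The curve is irreducible because the cubic has no root in ℂ(t); `w` is a rational function of `t`
and `η`, and ℂ(w) has no nonzero regular differential. -/

theorem mvPolynomial_aeval_eq_aevalAeval {K : Type*} [CommRing K] [Algebra ℂ K] (x y : K)
    (G : MvPolynomial (Fin 2) ℂ) :
    MvPolynomial.aeval (R := ℂ) ![x, y] G =
      Polynomial.aevalAeval x y ((Polynomial.Bivariate.equivMvPolynomial ℂ).symm G) := by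
  have h : MvPolynomial.aeval (R := ℂ) ![x, y] =
      (Polynomial.aevalAeval x y).comp
        ((Polynomial.Bivariate.equivMvPolynomial ℂ).symm : MvPolynomial (Fin 2) ℂ →ₐ[ℂ] ℂ[X][X]) := by
    ext i
    fin_cases i <;> simp
  rw [h]
  rfl

/-- A primitive bivariate polynomial, irreducible over `ℂ(X)`, that vanishes at a pair `(x, y)` with
`x` transcendental generates the ideal of relations between `x` and `y`. -/
theorem dvd_of_aevalAeval_eq_zero {K : Type*} [Field K] [Algebra ℂ K] {x y : K}
    (hx : Transcendental ℂ x) {F G : ℂ[X][X]} (hF : F.IsPrimitive)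
    (hirr : Irreducible (F.map (algebraMap ℂ[X] (RatFunc ℂ))))
    (hF0 : Polynomial.aevalAeval x y F = 0) (hG0 : Polynomial.aevalAeval x y G = 0) : F ∣ G := by
  have hinj : Function.Injective (Polynomial.aeval x : ℂ[X] →ₐ[ℂ] K).toRingHom :=
    transcendental_iff_injective.mp hx
  let ψ : RatFunc ℂ →+* K := IsFractionRing.lift hinj
  have hψ (H : ℂ[X][X]) : Polynomial.eval₂ ψ y (H.map (algebraMap ℂ[X] (RatFunc ℂ))) =
      Polynomial.aevalAeval x y H := by
    rw [Polynomial.eval₂_map]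
    have : ψ.comp (algebraMap ℂ[X] (RatFunc ℂ)) = (Polynomial.aeval x : ℂ[X] →ₐ[ℂ] K).toRingHom := by
      exact RingHom.ext fun p => IsFractionRing.lift_algebraMap hinj p
    rw [this]
    induction H using Polynomial.induction_on' with
    | add p q hp hq => rw [Polynomial.eval₂_add, map_add, hp, hq]
    | monomial n a =>
      rw [Polynomial.eval₂_monomial, ← Polynomial.C_mul_X_pow_eq_monomial, map_mul, map_pow,
        Polynomial.aevalAeval_C, Polynomial.aevalAeval_Y]
      rfl
  -- Gauss's lemma moves the divisibility to ℂ(X). There an irreducible `F` not dividing `G` is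
  -- coprime to it, and the Bézout relation evaluated at (x, y) reads 0 = 1.
  refine hF.dvd_of_fraction_map_dvd_fraction_map (K := RatFunc ℂ) ?_
  by_contra hnd
  obtain ⟨a, b, hab⟩ := (hirr.coprime_iff_not_dvd).mpr hnd
  have := congrArg (Polynomial.eval₂ ψ y) hab
  simp [hψ, hF0, hG0] at this

theorem isFunctionFieldOf_of_irreducible {K : Type} [Field K] [Algebra ℂ K] {x y : K}
    (hx : Transcendental ℂ x) {F : MvPolynomial (Fin 2) ℂ}
    (hF : ((Polynomial.Bivariate.equivMvPolynomial ℂ).symm F).IsPrimitive)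
    (hirr : Irreducible
      (((Polynomial.Bivariate.equivMvPolynomial ℂ).symm F).map (algebraMap ℂ[X] (RatFunc ℂ))))
    (h0 : MvPolynomial.aeval (R := ℂ) ![x, y] F = 0)
    (hgen : IntermediateField.adjoin ℂ {x, y} = ⊤) : IsFunctionFieldOf F x y := by
  refine ⟨le_antisymm (fun G hG => ?_) ?_, hgen⟩
  · rw [RingHom.mem_ker, mvPolynomial_aeval_eq_aevalAeval] at hG
    rw [mvPolynomial_aeval_eq_aevalAeval] at h0
    rw [Ideal.mem_span_singleton]
    simpa using map_dvd (Polynomial.Bivariate.equivMvPolynomial ℂ)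
      (dvd_of_aevalAeval_eq_zero hx hF hirr h0 hG)
  · rw [Ideal.span_singleton_le_iff_mem]
    exact h0

/-! ### The cubic curve -/

theorem equivMvPolynomial_symm_etaCurve :
    (Polynomial.Bivariate.equivMvPolynomial ℂ).symm etaCurve =
      Polynomial.C (-(2 * (1 - 3 * Polynomial.X ^ 2 + 3 * Polynomial.X ^ 4))) * Polynomial.X ^ 3
      + Polynomial.C 0 * Polynomial.X ^ 2
      + Polynomial.C (3 * Polynomial.X * (1 + Polynomial.X)) * Polynomial.X
      + Polynomial.C (2 + 3 * Polynomial.X) := by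
  simp only [etaCurve, map_add, map_sub, map_mul, map_pow, map_ofNat, map_one, map_neg,
    Polynomial.Bivariate.equivMvPolynomial_symm_X_0, Polynomial.Bivariate.equivMvPolynomial_symm_X_1,
    map_zero]
  ring

theorem isPrimitive_etaCurve :
    ((Polynomial.Bivariate.equivMvPolynomial ℂ).symm etaCurve).IsPrimitive := by
  intro r hr
  rw [Polynomial.C_dvd_iff_dvd_coeff, equivMvPolynomial_symm_etaCurve] at hr
  have h0 := hr 0
  have h3 := hr 3
  have hcoeff (a b c d : ℂ[X]) : (Polynomial.C a * Polynomial.X ^ 3 + Polynomial.C b * Polynomial.X ^ 2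
      + Polynomial.C c * Polynomial.X + Polynomial.C d).coeff 0 = d ∧
      (Polynomial.C a * Polynomial.X ^ 3 + Polynomial.C b * Polynomial.X ^ 2
      + Polynomial.C c * Polynomial.X + Polynomial.C d).coeff 3 = a := by
    simp [Polynomial.coeff_X, Polynomial.coeff_C]
  rw [(hcoeff _ _ _ _).1] at h0
  rw [(hcoeff _ _ _ _).2, dvd_neg] at h3
  have hP : r ∣ 2 * (1 - 3 * Polynomial.X ^ 2 + 3 * Polynomial.X ^ 4) := h3
  -- Division of the quartic by 2 + 3X: the remainder 7/27 is its value at -2/3.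
  have hc : Polynomial.C (7 / 27 : ℂ) = (1 - 3 * Polynomial.X ^ 2 + 3 * Polynomial.X ^ 4) -
      (2 + 3 * Polynomial.X) * (Polynomial.X ^ 3 - Polynomial.C (2 / 3) * Polynomial.X ^ 2
        - Polynomial.C (5 / 9) * Polynomial.X + Polynomial.C (10 / 27)) := by
    apply Polynomial.funext
    intro z
    simp
    ring
  have h2 : IsUnit (2 : ℂ[X]) := by
    rw [← map_ofNat Polynomial.C 2]
    exact Polynomial.isUnit_C.mpr (by simp)
  have hP' := (h2.dvd_mul_left).mp hP
  have : r ∣ Polynomial.C (7 / 27 : ℂ) := by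
    rw [hc]
    exact dvd_sub hP' (h0.mul_right _)
  exact isUnit_of_dvd_unit this (Polynomial.isUnit_C.mpr (by norm_num))

theorem natDegree_eq_zero_of_quartic_eq_sq_mul {q s : ℂ[X]}
    (h : 1 - 3 * Polynomial.X ^ 2 + 3 * Polynomial.X ^ 4 = q ^ 2 * s) : q.natDegree = 0 := by
  by_contra hq
  obtain ⟨a, ha⟩ := IsAlgClosed.exists_root q (fun h0 => hq (Polynomial.natDegree_eq_of_degree_eq_some h0))
  have ha : q.eval a = 0 := ha
  have h1 := congrArg (Polynomial.eval a) h
  have h2 := congrArg (fun p => Polynomial.eval a (Polynomial.derivative p)) h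
  simp [ha, pow_two] at h1
  simp [ha, Polynomial.derivative_pow] at h2
  -- Bézout identity between the quartic and its derivative: the quartic is squarefree.
  have : (1 : ℂ) = 0 := by
    linear_combination (1 + 6 * a ^ 2) * h1 + (a / 2 - 3 / 2 * a ^ 3) * h2
  exact one_ne_zero this

/-- For a root p/q in lowest terms, q² divides the squarefree quartic, so q = 1. A polynomial root
is then excluded by degrees: 4 + 3 deg p on one side, at most 2 + deg p on the other. -/
theorem etaCurve_no_root (r : RatFunc ℂ) : ¬ Polynomial.IsRoot
    (((Polynomial.Bivariate.equivMvPolynomial ℂ).symm etaCurve).map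
      (algebraMap ℂ[X] (RatFunc ℂ))) r := by
  intro hr
  rw [equivMvPolynomial_symm_etaCurve] at hr
  have hq0 := r.denom_ne_zero
  have hcop := r.isCoprime_num_denom
  have hr' := r.num_div_denom
  set p := r.num
  set q := r.denom
  have hqK : (algebraMap ℂ[X] (RatFunc ℂ)) q ≠ 0 := by simpa using hq0
  simp only [Polynomial.IsRoot, Polynomial.eval_map, Polynomial.eval₂_add, Polynomial.eval₂_mul,
    Polynomial.eval₂_C, Polynomial.eval₂_X, Polynomial.eval₂_pow] at hr
  rw [← hr'] at hr
  have key : 2 * (1 - 3 * Polynomial.X ^ 2 + 3 * Polynomial.X ^ 4) * p ^ 3 =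
      (2 + 3 * Polynomial.X) * q ^ 3 + 3 * Polynomial.X * (1 + Polynomial.X) * p * q ^ 2 := by
    apply RatFunc.algebraMap_injective ℂ
    simp only [map_add, map_sub, map_mul, map_pow, map_ofNat, map_one, map_neg, map_zero] at hr ⊢
    field_simp at hr
    linear_combination -hr
  have hdvd : q ^ 2 ∣ 1 - 3 * Polynomial.X ^ 2 + 3 * Polynomial.X ^ 4 := by
    have h1 : q ^ 2 ∣ (2 * (1 - 3 * Polynomial.X ^ 2 + 3 * Polynomial.X ^ 4)) * p ^ 3 := by
      rw [key]
      exact ⟨(2 + 3 * Polynomial.X) * q + 3 * Polynomial.X * (1 + Polynomial.X) * p, by ring⟩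
    have h2 := (hcop.symm.pow (m := 2) (n := 3)).dvd_of_dvd_mul_right h1
    have hu : IsUnit (2 : ℂ[X]) := by
      rw [← map_ofNat Polynomial.C 2]
      exact Polynomial.isUnit_C.mpr (by simp)
    exact (hu.dvd_mul_left).mp h2
  obtain ⟨s, hs⟩ := hdvd
  have hq1 : q = 1 :=
    Polynomial.eq_one_of_monic_natDegree_zero r.monic_denom (natDegree_eq_zero_of_quartic_eq_sq_mul hs)
  rw [hq1] at key
  have hp : p ≠ 0 := by
    intro hp
    rw [hp] at key
    have := congrArg (Polynomial.eval 0) key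
    simp at this
  have hL : (2 * (1 - 3 * Polynomial.X ^ 2 + 3 * Polynomial.X ^ 4) * p ^ 3).natDegree
      = 4 + 3 * p.natDegree := by
    have h4 : (2 * (1 - 3 * Polynomial.X ^ 2 + 3 * Polynomial.X ^ 4) : ℂ[X]).natDegree = 4 := by
      compute_degree!
    rw [Polynomial.natDegree_mul (by intro h0; simp [h0] at h4) (pow_ne_zero _ hp), h4,
      Polynomial.natDegree_pow]
  have hR : ((2 + 3 * Polynomial.X) * 1 ^ 3 + 3 * Polynomial.X * (1 + Polynomial.X) * p * 1 ^ 2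
      ).natDegree ≤ 2 + p.natDegree := by
    rw [one_pow, one_pow, mul_one, mul_one]
    have h1 : (2 + 3 * Polynomial.X : ℂ[X]).natDegree ≤ 1 := by compute_degree
    have h2 : (3 * Polynomial.X * (1 + Polynomial.X) : ℂ[X]).natDegree ≤ 2 := by compute_degree
    refine (Polynomial.natDegree_add_le _ _).trans (max_le (by omega) ?_)
    exact Polynomial.natDegree_mul_le.trans (by omega)
  rw [key] at hL
  omega

theorem irreducible_etaCurve_map : Irreducible
    (((Polynomial.Bivariate.equivMvPolynomial ℂ).symm etaCurve).map
      (algebraMap ℂ[X] (RatFunc ℂ))) := by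
  refine Polynomial.irreducible_of_degree_le_three_of_not_isRoot ?_ etaCurve_no_root
  have hne : (-(2 * (1 - 3 * Polynomial.X ^ 2 + 3 * Polynomial.X ^ 4)) : ℂ[X]) ≠ 0 := by
    intro h0
    have := congrArg (Polynomial.eval 0) h0
    simp at this
  rw [Polynomial.natDegree_map_eq_of_injective (RatFunc.algebraMap_injective ℂ),
    equivMvPolynomial_symm_etaCurve, Polynomial.natDegree_cubic hne]
  simp

/-! ### The rational parametrization -/

theorem ratFunc_X_sq_add_one_ne_zero : (RatFunc.X ^ 2 + 1 : RatFunc ℂ) ≠ 0 := by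
  have : (Polynomial.X ^ 2 + 1 : ℂ[X]) ≠ 0 := fun h0 => by
    simpa using congrArg (Polynomial.eval 0) h0
  have := (map_ne_zero_iff _ (RatFunc.algebraMap_injective ℂ)).mpr this
  simpa using this

theorem ratFunc_X_pow_four_add_three_ne_zero : (RatFunc.X ^ 4 + 3 : RatFunc ℂ) ≠ 0 := by
  have : (Polynomial.X ^ 4 + 3 : ℂ[X]) ≠ 0 := fun h0 => by
    simpa using congrArg (Polynomial.eval 0) h0
  have := (map_ne_zero_iff _ (RatFunc.algebraMap_injective ℂ)).mpr this
  simpa only [map_add, map_pow, map_ofNat, RatFunc.algebraMap_X] using this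

theorem ratFunc_three_ne_zero : (3 : RatFunc ℂ) ≠ 0 := by
  have : (algebraMap ℂ (RatFunc ℂ)) 3 ≠ 0 := by simp
  simpa only [map_ofNat] using this

theorem transcendental_tParam : Transcendental ℂ
    (1 / 3 * (((RatFunc.X ^ 2 + 3) * RatFunc.X) / (RatFunc.X ^ 2 + 1)) : RatFunc ℂ) := by
  apply RatFunc.transcendental_of_ne_C
  rintro ⟨c, hc⟩
  have h1 := ratFunc_X_sq_add_one_ne_zero
  have h3 := ratFunc_three_ne_zero
  have key : ((Polynomial.X ^ 2 + 3) * Polynomial.X : ℂ[X]) =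
      Polynomial.C c * 3 * (Polynomial.X ^ 2 + 1) := by
    apply RatFunc.algebraMap_injective ℂ
    simp only [map_add, map_mul, map_pow, map_ofNat, map_one, RatFunc.algebraMap_X,
      RatFunc.algebraMap_C]
    rw [← hc]
    field_simp
  have e1 := congrArg (Polynomial.eval 0) key
  have e2 := congrArg (Polynomial.eval 1) key
  simp at e1
  simp [e1] at e2
  norm_num at e2

theorem isFunctionFieldOf_param : IsFunctionFieldOf etaCurve
    (1 / 3 * (((RatFunc.X ^ 2 + 3) * RatFunc.X) / (RatFunc.X ^ 2 + 1)) : RatFunc ℂ)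
    (3 * (((RatFunc.X + 1) * (RatFunc.X ^ 2 + 1)) / (RatFunc.X ^ 4 + 3))) := by
  have h1 := ratFunc_X_sq_add_one_ne_zero
  have h3 := ratFunc_three_ne_zero
  have h4 := ratFunc_X_pow_four_add_three_ne_zero
  have htr := transcendental_tParam
  refine isFunctionFieldOf_of_irreducible htr isPrimitive_etaCurve irreducible_etaCurve_map ?_ ?_
  · simp only [etaCurve, map_add, map_sub, map_mul, map_pow, map_ofNat, map_one,
      MvPolynomial.aeval_X, Matrix.cons_val_zero, Matrix.cons_val_one]
    field_simp
    ring
  · set t : RatFunc ℂ := 1 / 3 * (((RatFunc.X ^ 2 + 3) * RatFunc.X) / (RatFunc.X ^ 2 + 1)) with ht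
    set y : RatFunc ℂ := 3 * (((RatFunc.X + 1) * (RatFunc.X ^ 2 + 1)) / (RatFunc.X ^ 4 + 3)) with hy
    have hd : 5 * t ^ 3 + 3 * t ^ 2 - 3 * t - 2 ≠ 0 := by
      intro h0
      refine htr ⟨5 * Polynomial.X ^ 3 + 3 * Polynomial.X ^ 2 - 3 * Polynomial.X - 2, ?_, ?_⟩
      · intro h
        have := congrArg (Polynomial.eval 0) h
        simp at this
      · simpa only [map_add, map_sub, map_mul, map_pow, map_ofNat, Polynomial.aeval_X] using h0
    -- ℂ(w) has degree 3 over ℂ(t), so `w` is a combination of 1, y, y² with coefficients in ℂ(t);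
    -- these are the coefficients over a common denominator.
    have hX : RatFunc.X = ((t ^ 2 + 3 * t ^ 3 + 3 * t ^ 4)
        + y * (2 + 2 * t - 6 * t ^ 2 - 6 * t ^ 3 + 6 * t ^ 4 + 6 * t ^ 5)
        + y ^ 2 * (-2 - 2 * t + 8 * t ^ 2 + 6 * t ^ 3 - 12 * t ^ 4 - 6 * t ^ 5 + 6 * t ^ 6))
        / (5 * t ^ 3 + 3 * t ^ 2 - 3 * t - 2) := by
      rw [eq_div_iff hd, ht, hy]
      field_simp
      ring
    rw [eq_top_iff, ← RatFunc.adjoin_X (K := ℂ),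
      IntermediateField.adjoin_simple_le_iff]
    have htm : t ∈ IntermediateField.adjoin ℂ {t, y} :=
      IntermediateField.subset_adjoin _ _ (by simp)
    have hym : y ∈ IntermediateField.adjoin ℂ {t, y} :=
      IntermediateField.subset_adjoin _ _ (by simp)
    generalize IntermediateField.adjoin ℂ {t, y} = E at htm hym
    -- The same formula computed inside the subfield `E`, which gives membership at once.
    have e : RatFunc.X = (((((⟨t, htm⟩ : E) ^ 2 + 3 * ⟨t, htm⟩ ^ 3 + 3 * ⟨t, htm⟩ ^ 4)
        + ⟨y, hym⟩ * (2 + 2 * ⟨t, htm⟩ - 6 * ⟨t, htm⟩ ^ 2 - 6 * ⟨t, htm⟩ ^ 3 + 6 * ⟨t, htm⟩ ^ 4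
          + 6 * ⟨t, htm⟩ ^ 5)
        + ⟨y, hym⟩ ^ 2 * (-2 - 2 * ⟨t, htm⟩ + 8 * ⟨t, htm⟩ ^ 2 + 6 * ⟨t, htm⟩ ^ 3
          - 12 * ⟨t, htm⟩ ^ 4 - 6 * ⟨t, htm⟩ ^ 5 + 6 * ⟨t, htm⟩ ^ 6))
        / (5 * ⟨t, htm⟩ ^ 3 + 3 * ⟨t, htm⟩ ^ 2 - 3 * ⟨t, htm⟩ - 2) : E) : RatFunc ℂ) := by
      rw [hX]
      push_cast
      rfl
    rw [e]
    exact SetLike.coe_mem _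

/-! ### Regular differentials of the rational function field -/

/-- The differentials of `ℂ(X)` are the multiples of `dX`. -/
noncomputable def ratFuncDifferentialEquiv : Ω[RatFunc ℂ⁄ℂ] ≃ₗ[RatFunc ℂ] RatFunc ℂ :=
  haveI : Algebra.FormallyEtale ℂ[X] (RatFunc ℂ) :=
    .of_isLocalization (nonZeroDivisors ℂ[X])
  (KaehlerDifferential.tensorKaehlerEquivOfFormallyEtale ℂ ℂ[X] (RatFunc ℂ)).symm ≪≫ₗ
    TensorProduct.AlgebraTensorModule.congr (LinearEquiv.refl (RatFunc ℂ) (RatFunc ℂ))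
      (KaehlerDifferential.polynomialEquiv ℂ) ≪≫ₗ
    TensorProduct.AlgebraTensorModule.rid ℂ[X] (RatFunc ℂ) (RatFunc ℂ)

theorem ratFuncDifferentialEquiv_D_algebraMap (p : ℂ[X]) :
    ratFuncDifferentialEquiv (KaehlerDifferential.D ℂ (RatFunc ℂ) (algebraMap ℂ[X] (RatFunc ℂ) p)) =
      algebraMap ℂ[X] (RatFunc ℂ) (Polynomial.derivative p) := by
  have : Algebra.FormallyEtale ℂ[X] (RatFunc ℂ) :=
    .of_isLocalization (nonZeroDivisors ℂ[X])
  simp [ratFuncDifferentialEquiv,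
    KaehlerDifferential.tensorKaehlerEquivOfFormallyEtale_symm_D_algebraMap, Algebra.smul_def]

theorem ratFuncDifferentialEquiv_D_div (p q : ℂ[X]) (hq : q ≠ 0) :
    ratFuncDifferentialEquiv (KaehlerDifferential.D ℂ (RatFunc ℂ)
      (algebraMap ℂ[X] (RatFunc ℂ) p / algebraMap ℂ[X] (RatFunc ℂ) q)) =
      algebraMap ℂ[X] (RatFunc ℂ) (Polynomial.derivative p * q - p * Polynomial.derivative q) /
        algebraMap ℂ[X] (RatFunc ℂ) (q ^ 2) := by
  have hqK : algebraMap ℂ[X] (RatFunc ℂ) q ≠ 0 := by simpa using hq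
  set a := algebraMap ℂ[X] (RatFunc ℂ) p / algebraMap ℂ[X] (RatFunc ℂ) q with ha
  have h1 : algebraMap ℂ[X] (RatFunc ℂ) p = a * algebraMap ℂ[X] (RatFunc ℂ) q := by
    rw [ha, div_mul_cancel₀ _ hqK]
  have h2 := congrArg (fun x => ratFuncDifferentialEquiv (KaehlerDifferential.D ℂ (RatFunc ℂ) x)) h1
  simp only [Derivation.leibniz, map_add, map_smul, ratFuncDifferentialEquiv_D_algebraMap,
    smul_eq_mul] at h2
  rw [map_sub, map_mul, map_mul, map_pow, eq_div_iff (pow_ne_zero _ hqK), h2, h1]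
  ring

/-- The valuation ring of `ℂ(X)` at the point `c`. -/
noncomputable def ratFuncValuationSubring (c : ℂ) : ValuationSubring (RatFunc ℂ) where
  carrier := {f | ∃ p q : ℂ[X], q.eval c ≠ 0 ∧
    f = algebraMap ℂ[X] (RatFunc ℂ) p / algebraMap ℂ[X] (RatFunc ℂ) q}
  mul_mem' := by
    rintro _ _ ⟨p, q, hq, rfl⟩ ⟨p', q', hq', rfl⟩
    exact ⟨p * p', q * q', by simp [hq, hq'], by simp [div_mul_div_comm]⟩
  one_mem' := ⟨1, 1, by simp, by simp⟩
  add_mem' := by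
    rintro _ _ ⟨p, q, hq, rfl⟩ ⟨p', q', hq', rfl⟩
    have h : algebraMap ℂ[X] (RatFunc ℂ) q ≠ 0 := by
      simpa using fun h : q = 0 => hq (by simp [h])
    have h' : algebraMap ℂ[X] (RatFunc ℂ) q' ≠ 0 := by
      simpa using fun h : q' = 0 => hq' (by simp [h])
    exact ⟨p * q' + q * p', q * q', by simp [hq, hq'], by simp [div_add_div _ _ h h']⟩
  zero_mem' := ⟨0, 1, by simp, by simp⟩
  neg_mem' := by
    rintro _ ⟨p, q, hq, rfl⟩
    exact ⟨-p, q, hq, by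
      rw [map_neg]
      exact (neg_div _ _).symm⟩
  mem_or_inv_mem' := by
    intro f
    by_cases h : f.denom.eval c = 0
    · refine Or.inr ⟨f.denom, f.num, fun h' => ?_, ?_⟩
      · obtain ⟨a, b, hab⟩ := f.isCoprime_num_denom
        simpa [h, h'] using congrArg (Polynomial.eval c) hab
      · conv_lhs => rw [← f.num_div_denom, inv_div]
    · exact Or.inl ⟨f.num, f.denom, h, f.num_div_denom.symm⟩

/-- The valuation ring of `ℂ(X)` at infinity. -/
noncomputable def ratFuncValuationSubringInfty : ValuationSubring (RatFunc ℂ) where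
  carrier := {f | ∃ p q : ℂ[X], q ≠ 0 ∧ p.natDegree ≤ q.natDegree ∧
    f = algebraMap ℂ[X] (RatFunc ℂ) p / algebraMap ℂ[X] (RatFunc ℂ) q}
  mul_mem' := by
    rintro _ _ ⟨p, q, hq, hd, rfl⟩ ⟨p', q', hq', hd', rfl⟩
    refine ⟨p * p', q * q', mul_ne_zero hq hq', ?_, by simp [div_mul_div_comm]⟩
    rw [Polynomial.natDegree_mul hq hq']
    exact Polynomial.natDegree_mul_le.trans (add_le_add hd hd')
  one_mem' := ⟨1, 1, by simp, by simp, by simp⟩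
  add_mem' := by
    rintro _ _ ⟨p, q, hq, hd, rfl⟩ ⟨p', q', hq', hd', rfl⟩
    have h : algebraMap ℂ[X] (RatFunc ℂ) q ≠ 0 := by simpa using hq
    have h' : algebraMap ℂ[X] (RatFunc ℂ) q' ≠ 0 := by simpa using hq'
    refine ⟨p * q' + q * p', q * q', mul_ne_zero hq hq', ?_, by simp [div_add_div _ _ h h']⟩
    rw [Polynomial.natDegree_mul hq hq']
    exact (Polynomial.natDegree_add_le _ _).trans (max_le
      (Polynomial.natDegree_mul_le.trans (by omega)) (Polynomial.natDegree_mul_le.trans (by omega)))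
  zero_mem' := ⟨0, 1, by simp, by simp, by simp⟩
  neg_mem' := by
    rintro _ ⟨p, q, hq, hd, rfl⟩
    exact ⟨-p, q, hq, by simpa using hd, by
      rw [map_neg]
      exact (neg_div _ _).symm⟩
  mem_or_inv_mem' := by
    intro f
    rcases le_total f.num.natDegree f.denom.natDegree with h | h
    · exact Or.inl ⟨f.num, f.denom, f.denom_ne_zero, h, f.num_div_denom.symm⟩
    · by_cases hf : f = 0
      · exact Or.inl ⟨0, 1, by simp, by simp, by simp [hf]⟩
      · refine Or.inr ⟨f.denom, f.num, RatFunc.num_ne_zero hf, h, ?_⟩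
        conv_lhs => rw [← f.num_div_denom, inv_div]

theorem natDegree_X_mul_derivative_le (p : ℂ[X]) :
    (Polynomial.X * Polynomial.derivative p).natDegree ≤ p.natDegree := by
  rcases Nat.eq_zero_or_pos p.natDegree with h | h
  · rw [Polynomial.eq_C_of_natDegree_eq_zero h]
    simp
  · have := Polynomial.natDegree_derivative_le p
    refine Polynomial.natDegree_mul_le.trans ?_
    rw [Polynomial.natDegree_X]
    omega

/-- A bound on the generators df extends to their `O`-span. The multiplier `a` is 1 at finite points
and X at infinity. -/
theorem regularDifferentials_apply_mem {ω : Ω[RatFunc ℂ⁄ℂ]}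
    (hω : ω ∈ regularDifferentials (RatFunc ℂ)) (O : ValuationSubring (RatFunc ℂ))
    (hO : ∀ c : ℂ, algebraMap ℂ (RatFunc ℂ) c ∈ O) (a : RatFunc ℂ)
    (ha : ∀ f ∈ O, a * ratFuncDifferentialEquiv (KaehlerDifferential.D ℂ (RatFunc ℂ) f) ∈ O) :
    a * ratFuncDifferentialEquiv ω ∈ O := by
  have h := hω O hO
  clear hω
  induction h using Submodule.span_induction with
  | mem x hx =>
    obtain ⟨f, hf, rfl⟩ := hx
    exact ha f hf
  | zero => simp
  | add x y _ _ hx hy =>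
    rw [map_add, mul_add]
    exact add_mem hx hy
  | smul b x _ hx =>
    have e : ratFuncDifferentialEquiv (b • x) = (b : RatFunc ℂ) * ratFuncDifferentialEquiv x :=
      map_smul ratFuncDifferentialEquiv (b : RatFunc ℂ) x
    rw [e, mul_left_comm]
    exact mul_mem b.2 hx

/-- Regularity of f dX at every finite point makes f a polynomial; at infinity it bounds the degree
of X f by 0, so f = 0. -/
theorem regularDifferentials_ratFunc : regularDifferentials (RatFunc ℂ) = ⊥ := by
  rw [eq_bot_iff]
  intro ω hω
  rw [Submodule.mem_bot]
  set f := ratFuncDifferentialEquiv ω with hf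
  have hc (c : ℂ) : f ∈ ratFuncValuationSubring c := by
    have h := regularDifferentials_apply_mem hω (ratFuncValuationSubring c)
      (fun b => ⟨Polynomial.C b, 1, by simp, by simp⟩) 1 ?_
    · simpa using h
    · rintro _ ⟨p, q, hq, rfl⟩
      rw [one_mul, ratFuncDifferentialEquiv_D_div p q (fun h => hq (by simp [h]))]
      exact ⟨_, _, by simpa using hq, rfl⟩
  -- Differentiation lowers the degree at infinity by at least one. In fact dX has a double pole
  -- there, but the single factor X already suffices.
  have hinf : RatFunc.X * f ∈ ratFuncValuationSubringInfty := by
    refine regularDifferentials_apply_mem hω ratFuncValuationSubringInfty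
      (fun b => ⟨Polynomial.C b, 1, by simp, by simp, by simp⟩) _ ?_
    rintro _ ⟨p, q, hq, hd, rfl⟩
    rw [ratFuncDifferentialEquiv_D_div p q hq]
    refine ⟨Polynomial.X * (Polynomial.derivative p * q - p * Polynomial.derivative q), q ^ 2,
      pow_ne_zero _ hq, ?_, by rw [map_mul, RatFunc.algebraMap_X, mul_div_assoc]⟩
    have h1 := natDegree_X_mul_derivative_le p
    have h2 := natDegree_X_mul_derivative_le q
    rw [Polynomial.natDegree_pow, show Polynomial.X *
      (Polynomial.derivative p * q - p * Polynomial.derivative q) =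
      (Polynomial.X * Polynomial.derivative p) * q - p * (Polynomial.X * Polynomial.derivative q)
      by ring]
    exact (Polynomial.natDegree_sub_le _ _).trans (max_le
      (Polynomial.natDegree_mul_le.trans (by omega)) (Polynomial.natDegree_mul_le.trans (by omega)))
  have hden : f.denom = 1 := by
    refine Polynomial.eq_one_of_monic_natDegree_zero f.monic_denom ?_
    by_contra hd
    obtain ⟨c, hroot⟩ := IsAlgClosed.exists_root f.denom
      (fun h0 => hd (Polynomial.natDegree_eq_of_degree_eq_some h0))
    obtain ⟨p, q, hq, hpq⟩ := hc c
    have hdvd : f.denom ∣ q :=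
      RatFunc.denom_dvd (fun h => hq (by simp [h])) |>.mpr ⟨p, hpq⟩
    exact hq (Polynomial.eval_eq_zero_of_dvd_of_eval_eq_zero hdvd hroot)
  obtain ⟨p, q, hq, hd, hpq⟩ := hinf
  have hnum : f = algebraMap ℂ[X] (RatFunc ℂ) f.num := by
    conv_lhs => rw [← f.num_div_denom, hden, map_one, div_one]
  have hqK : algebraMap ℂ[X] (RatFunc ℂ) q ≠ 0 := by simpa using hq
  have hpoly : Polynomial.X * f.num * q = p := by
    apply RatFunc.algebraMap_injective ℂ
    rw [eq_div_iff hqK] at hpq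
    rw [map_mul, map_mul, RatFunc.algebraMap_X, ← hnum, hpq]
  have hn : f.num = 0 := by
    by_contra hn
    rw [← hpoly, Polynomial.natDegree_mul (mul_ne_zero Polynomial.X_ne_zero hn) hq,
      Polynomial.natDegree_mul Polynomial.X_ne_zero hn, Polynomial.natDegree_X] at hd
    omega
  rw [hn, map_zero] at hnum
  exact ratFuncDifferentialEquiv.map_eq_zero_iff.mp hnum

theorem planeCurveHasGenus_etaCurve : PlaneCurveHasGenus etaCurve 0 := by
  refine ⟨RatFunc ℂ, inferInstance, inferInstance, _, _, isFunctionFieldOf_param, ?_⟩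
  rw [regularDifferentials_ratFunc]
  simp

/-! ### Taylor coefficients of solutions of the differential system -/

/-- Multiplication by t shifts the Taylor coefficients. At k = 0 the truncated index k - 1 is
harmless, since its factor k vanishes. -/
theorem iteratedDeriv_id_mul_zero {g : ℂ → ℂ} (hg : AnalyticAt ℂ g 0) (k : ℕ) :
    iteratedDeriv k (fun t => t * g t) 0 = k * iteratedDeriv (k - 1) g 0 := by
  induction k generalizing g with
  | zero => simp
  | succ k ih =>
    have hd : deriv (fun t => t * g t) =ᶠ[𝓝 0] fun t => g t + t * deriv g t := by
      filter_upwards [hg.eventually_analyticAt] with t ht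
      rw [deriv_fun_mul differentiableAt_fun_id ht.differentiableAt]
      simp
    rw [iteratedDeriv_succ', hd.iteratedDeriv_eq, iteratedDeriv_fun_add (g := fun t => t * deriv g t)
      hg.contDiffAt (analyticAt_id.mul hg.deriv).contDiffAt, ih hg.deriv]
    cases k with
    | zero => simp
    | succ n =>
      rw [Nat.add_sub_cancel, Nat.add_sub_cancel, ← iteratedDeriv_succ']
      push_cast
      ring

/-- The Taylor coefficients (times factorials) of the solution of the system
`O' = zE + tE' + E + tO + t²O'`, `E' = zO - tO' + 3tE + 3t²E'`. -/
theorem iteratedDeriv_system {E O : ℂ → ℂ} {z : ℂ} (hE : AnalyticAt ℂ E 0) (hO : AnalyticAt ℂ O 0)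
    (h1 : deriv O =ᶠ[𝓝 0] fun t => z * E t + t * deriv E t + E t + t * O t + t * (t * deriv O t))
    (h2 : deriv E =ᶠ[𝓝 0] fun t => z * O t - t * deriv O t + 3 * (t * E t)
      + 3 * (t * (t * deriv E t))) (k : ℕ) :
    iteratedDeriv (k + 1) O 0 =
      (z + k + 1) * iteratedDeriv k E 0 + k ^ 2 * iteratedDeriv (k - 1) O 0 ∧
    iteratedDeriv (k + 1) E 0 =
      (z - k) * iteratedDeriv k O 0 + 3 * k ^ 2 * iteratedDeriv (k - 1) E 0 := by
  have hE' := hE.deriv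
  have hO' := hO.deriv
  have hid : AnalyticAt ℂ (fun t : ℂ => t) 0 := analyticAt_id
  have m1 (g : ℂ → ℂ) (hg : AnalyticAt ℂ g 0) :
      iteratedDeriv k (fun t => t * deriv g t) 0 = k * iteratedDeriv k g 0 := by
    rw [iteratedDeriv_id_mul_zero hg.deriv]
    cases k with
    | zero => simp
    | succ n => rw [Nat.add_sub_cancel, iteratedDeriv_succ']
  have m2 (g : ℂ → ℂ) (hg : AnalyticAt ℂ g 0) :
      iteratedDeriv k (fun t => t * (t * deriv g t)) 0 =
        k * (k - 1) * iteratedDeriv (k - 1) g 0 := by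
    rw [iteratedDeriv_id_mul_zero (g := fun t => t * deriv g t) (hid.mul hg.deriv)]
    rcases k with _ | _ | n
    · simp
    · simp
    · rw [Nat.add_sub_cancel, iteratedDeriv_id_mul_zero hg.deriv, Nat.add_sub_cancel,
        ← iteratedDeriv_succ']
      push_cast
      ring
  constructor
  · rw [iteratedDeriv_succ', h1.iteratedDeriv_eq]
    rw [iteratedDeriv_fun_add, iteratedDeriv_fun_add, iteratedDeriv_fun_add, iteratedDeriv_fun_add,
      m1 E hE, m2 O hO, iteratedDeriv_id_mul_zero hO, iteratedDeriv_const_mul_field]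
    · ring
    all_goals exact AnalyticAt.contDiffAt (by fun_prop)
  · rw [iteratedDeriv_succ', h2.iteratedDeriv_eq]
    rw [iteratedDeriv_fun_add, iteratedDeriv_fun_add, iteratedDeriv_fun_sub,
      m1 O hO, iteratedDeriv_const_mul_field, iteratedDeriv_const_mul_field,
      iteratedDeriv_const_mul_field, m2 E hE, iteratedDeriv_id_mul_zero hE]
    · ring
    all_goals exact AnalyticAt.contDiffAt (by fun_prop)

/-! ### The recurrence of the reciprocal denominators -/

theorem recipDenom_zero : recipDenom 0 = 1 := by
  simp [recipDenom, jDenom, Polynomial.reflect_one]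

theorem recipDenom_one : recipDenom 1 = Polynomial.X + 1 := by
  simp [recipDenom, jDenom, jCoeffC, Polynomial.reflect_one]

theorem eval_recipDenom_add_two (k : ℕ) (z : ℂ) :
    (recipDenom (k + 2)).eval z = (z - jCoeffC (k + 1)) * (recipDenom (k + 1)).eval z
      - jCoeffA (k + 1) * (recipDenom k).eval z := by
  have h1 : Polynomial.reflect (k + 2) ((1 - Polynomial.C (jCoeffC (k + 1)) * Polynomial.X) *
      jDenom jCoeffC jCoeffA (k + 1)) = Polynomial.reflect 1 (1 - Polynomial.C (jCoeffC (k + 1)) *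
        Polynomial.X) * Polynomial.reflect (k + 1) (jDenom jCoeffC jCoeffA (k + 1)) := by
    rw [show k + 2 = 1 + (k + 1) by ring]
    exact Polynomial.reflect_mul _ _ (by compute_degree) (natDegree_jDenom_le _ _ _)
  have h2 : Polynomial.reflect (k + 2) (Polynomial.C (jCoeffA (k + 1)) * Polynomial.X ^ 2 *
      jDenom jCoeffC jCoeffA k) = Polynomial.reflect 2 (Polynomial.C (jCoeffA (k + 1)) *
        Polynomial.X ^ 2) * Polynomial.reflect k (jDenom jCoeffC jCoeffA k) := by
    rw [add_comm k 2]
    exact Polynomial.reflect_mul _ _ (by compute_degree) (natDegree_jDenom_le _ _ _)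
  have h3 : Polynomial.reflect 2 (Polynomial.X ^ 2 : ℂ[X]) = 1 := by
    rw [Polynomial.reflect_monomial, Polynomial.revAt_le le_rfl]
    simp
  unfold recipDenom
  rw [jDenom, Polynomial.reflect_sub, h1, h2, Polynomial.reflect_sub, Polynomial.reflect_one,
    Polynomial.reflect_C_mul, Polynomial.reflect_C_mul, Polynomial.reflect_one_X, h3]
  simp

/-- For even k, c_k = -(k + 1) and a_k = -k²; for odd k, c_k = k and a_k = -3k². The two relations
of `iteratedDeriv_system` are the recurrence of `q_k` for these two parities, and the initial values
annihilate the coefficients of the wrong parity. -/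
theorem iteratedDeriv_system_eq_recipDenom {E O : ℂ → ℂ} {z : ℂ} (hE : AnalyticAt ℂ E 0)
    (hO : AnalyticAt ℂ O 0)
    (h1 : deriv O =ᶠ[𝓝 0] fun t => z * E t + t * deriv E t + E t + t * O t + t * (t * deriv O t))
    (h2 : deriv E =ᶠ[𝓝 0] fun t => z * O t - t * deriv O t + 3 * (t * E t)
      + 3 * (t * (t * deriv E t))) (hE0 : E 0 = 1) (hO0 : O 0 = 0) (k : ℕ) :
    iteratedDeriv k E 0 = (1 + (-1) ^ k) / 2 * (recipDenom k).eval z ∧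
    iteratedDeriv k O 0 = (1 - (-1) ^ k) / 2 * (recipDenom k).eval z := by
  have hs := iteratedDeriv_system hE hO h1 h2
  have key : ∀ k, (iteratedDeriv k E 0 = (1 + (-1) ^ k) / 2 * (recipDenom k).eval z ∧
    iteratedDeriv k O 0 = (1 - (-1) ^ k) / 2 * (recipDenom k).eval z) ∧
    (iteratedDeriv (k + 1) E 0 = (1 + (-1) ^ (k + 1)) / 2 * (recipDenom (k + 1)).eval z ∧
    iteratedDeriv (k + 1) O 0 = (1 - (-1) ^ (k + 1)) / 2 * (recipDenom (k + 1)).eval z) := by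
    intro k
    induction k with
    | zero =>
      have := hs 0
      simp [hE0, hO0] at this
      simp [recipDenom_zero, recipDenom_one, hE0, hO0, this]
    | succ k ih =>
      refine ⟨ih.2, ?_⟩
      obtain ⟨a, b⟩ := hs (k + 1)
      rw [a, b, Nat.add_sub_cancel, ih.1.1, ih.1.2, ih.2.1, ih.2.2, eval_recipDenom_add_two]
      unfold jCoeffC jCoeffA
      rcases Nat.even_or_odd k with h | h
      · simp only [pow_succ, h.neg_one_pow]
        push_cast
        constructor <;> ring
      · simp only [pow_succ, h.neg_one_pow]
        push_cast
        constructor <;> ring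
  exact (key k).1

/-! ### The elliptic integral -/

/-- `√(1 - 3t² + 3t⁴)`, with the principal square root. -/
noncomputable def quarticSqrt (t : ℂ) : ℂ := (1 - 3 * t ^ 2 + 3 * t ^ 4) ^ (1 / 2 : ℂ)

theorem quarticSqrt_zero : quarticSqrt 0 = 1 := by simp [quarticSqrt]

theorem quarticSqrt_sq (t : ℂ) : quarticSqrt t ^ 2 = 1 - 3 * t ^ 2 + 3 * t ^ 4 := by
  rw [quarticSqrt, ← Complex.cpow_nat_mul]
  norm_num

/-- For |t| < 1/2 one has 3|t|² + 3|t|⁴ < 15/16, so the radicand stays within distance 1 of 1. -/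
theorem one_sub_quartic_mem_slitPlane {t : ℂ} (ht : t ∈ Metric.ball (0 : ℂ) (1 / 2)) :
    1 - 3 * t ^ 2 + 3 * t ^ 4 ∈ Complex.slitPlane := by
  rw [mem_ball_zero_iff] at ht
  have h : ‖(-3 * t ^ 2 + 3 * t ^ 4 : ℂ)‖ < 1 := by
    refine (norm_add_le _ _).trans_lt ?_
    simp only [norm_mul, norm_pow, norm_neg, Complex.norm_ofNat]
    have h2 : ‖t‖ ^ 2 < 1 / 4 := by nlinarith [norm_nonneg t]
    nlinarith [sq_nonneg (‖t‖ ^ 2), sq_nonneg ‖t‖]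
  have := Complex.mem_slitPlane_of_norm_lt_one h
  convert this using 1
  ring

theorem quarticSqrt_ne_zero {t : ℂ} (ht : t ∈ Metric.ball (0 : ℂ) (1 / 2)) :
    quarticSqrt t ≠ 0 := by
  intro h
  have := quarticSqrt_sq t
  rw [h] at this
  exact Complex.slitPlane_ne_zero (one_sub_quartic_mem_slitPlane ht) (by simpa using this.symm)

theorem hasDerivAt_quarticSqrt {t : ℂ} (ht : t ∈ Metric.ball (0 : ℂ) (1 / 2)) :
    HasDerivAt quarticSqrt ((6 * t ^ 3 - 3 * t) / quarticSqrt t) t := by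
  have hP : HasDerivAt (fun t : ℂ => 1 - 3 * t ^ 2 + 3 * t ^ 4) (-(6 * t) + 12 * t ^ 3) t := by
    have := (((hasDerivAt_pow 2 t).const_mul 3).const_sub 1).add ((hasDerivAt_pow 4 t).const_mul 3)
    refine this.congr_deriv ?_
    norm_num
    ring
  have hd : DifferentiableAt ℂ quarticSqrt t :=
    (hP.cpow_const (c := 1 / 2) (one_sub_quartic_mem_slitPlane ht)).differentiableAt
  have h0 := quarticSqrt_ne_zero ht
  -- The value of S' is obtained by differentiating S² = P, which avoids complex powers.
  have h1 : HasDerivAt (fun t => quarticSqrt t ^ 2) (-(6 * t) + 12 * t ^ 3) t := by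
    simpa only [quarticSqrt_sq] using hP
  have h2 := h1.unique (hd.hasDerivAt.pow 2)
  refine hd.hasDerivAt.congr_deriv ?_
  rw [eq_div_iff h0]
  norm_num at h2
  linear_combination -h2 / 2

/-- On the disc 1/S has a holomorphic primitive vanishing at 0; integration along the segment
identifies it with `ellipticJ`. -/
theorem hasDerivAt_ellipticJ {t : ℂ} (ht : t ∈ Metric.ball (0 : ℂ) (1 / 2)) :
    HasDerivAt ellipticJ (quarticSqrt t)⁻¹ t := by
  have hdiff : DifferentiableOn ℂ (fun t => (quarticSqrt t)⁻¹) (Metric.ball (0 : ℂ) (1 / 2)) :=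
    fun u hu => ((hasDerivAt_quarticSqrt hu).differentiableAt.inv
      (quarticSqrt_ne_zero hu)).differentiableWithinAt
  obtain ⟨G, hG0, hG⟩ := hdiff.isExactOn_ball.with_val_at 0 0
  have heq : ∀ u ∈ Metric.ball (0 : ℂ) (1 / 2), ellipticJ u = G u := by
    intro u hu
    have hmem : ∀ s ∈ Set.uIcc (0 : ℝ) 1, (s : ℂ) * u ∈ Metric.ball (0 : ℂ) (1 / 2) := by
      intro s hs
      rw [Set.uIcc_of_le zero_le_one] at hs
      rw [mem_ball_zero_iff] at hu ⊢
      rw [norm_mul, Complex.norm_real, Real.norm_of_nonneg hs.1]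
      nlinarith [norm_nonneg u, hs.2]
    have hder : ∀ s ∈ Set.uIcc (0 : ℝ) 1, HasDerivAt (fun s : ℝ => G ((s : ℂ) * u))
        (u / (1 - 3 * ((s : ℂ) * u) ^ 2 + 3 * ((s : ℂ) * u) ^ 4) ^ (1 / 2 : ℂ)) s := by
      intro s hs
      have h1 : HasDerivAt (fun s : ℝ => (s : ℂ) * u) u s := by
        simpa using (Complex.ofRealCLM.hasDerivAt (x := s)).mul_const u
      have h2 := (hG _ (hmem s hs)).comp s h1
      refine h2.congr_deriv ?_
      rw [div_eq_inv_mul]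
      rfl
    have hcont : ContinuousOn (fun s : ℝ =>
        u / (1 - 3 * ((s : ℂ) * u) ^ 2 + 3 * ((s : ℂ) * u) ^ 4) ^ (1 / 2 : ℂ))
        (Set.uIcc (0 : ℝ) 1) := by
      have : ContinuousOn (fun s : ℝ => u * (quarticSqrt ((s : ℂ) * u))⁻¹) (Set.uIcc (0 : ℝ) 1) :=
        continuousOn_const.mul (hdiff.continuousOn.comp (by fun_prop) hmem)
      exact this
    have := intervalIntegral.integral_eq_sub_of_hasDerivAt hder hcont.intervalIntegrable
    rw [ellipticJ, this]
    simp [hG0]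
  exact (hG t ht).congr_of_eventuallyEq
    (Filter.eventually_of_mem (Metric.isOpen_ball.mem_nhds ht) heq)

theorem ellipticJ_zero : ellipticJ 0 = 0 := by simp [ellipticJ]

theorem ball_half_mem_nhds : Metric.ball (0 : ℂ) (1 / 2) ∈ 𝓝 0 := Metric.ball_mem_nhds _ (by norm_num)

theorem analyticAt_of_differentiableAt_ball {f : ℂ → ℂ}
    (h : ∀ t ∈ Metric.ball (0 : ℂ) (1 / 2), DifferentiableAt ℂ f t) : AnalyticAt ℂ f 0 :=
  DifferentiableOn.analyticAt (fun t ht => (h t ht).differentiableWithinAt) ball_half_mem_nhds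

theorem analyticAt_quarticSqrt : AnalyticAt ℂ quarticSqrt 0 :=
  analyticAt_of_differentiableAt_ball fun _ ht => (hasDerivAt_quarticSqrt ht).differentiableAt

theorem analyticAt_ellipticJ : AnalyticAt ℂ ellipticJ 0 :=
  analyticAt_of_differentiableAt_ball fun _ ht => (hasDerivAt_ellipticJ ht).differentiableAt

/-- The function h = 1/S satisfies P h' = (3t - 6t³) h; solved for the constant term of P, this is a
recurrence for the Taylor coefficients. Every truncated index carries a vanishing factor. -/
theorem iteratedDeriv_inv_quarticSqrt (k : ℕ) :
    iteratedDeriv (k + 1) (fun t => (quarticSqrt t)⁻¹) 0 =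
      3 * (k * ((k - 1 : ℕ) * iteratedDeriv (k - 1 - 1 + 1) (fun t => (quarticSqrt t)⁻¹) 0))
      - 3 * (k * ((k - 1 : ℕ) * ((k - 1 - 1 : ℕ) * ((k - 1 - 1 - 1 : ℕ) *
        iteratedDeriv (k - 1 - 1 - 1 - 1 + 1) (fun t => (quarticSqrt t)⁻¹) 0))))
      + 3 * (k * iteratedDeriv (k - 1) (fun t => (quarticSqrt t)⁻¹) 0)
      - 6 * (k * ((k - 1 : ℕ) * ((k - 1 - 1 : ℕ) *
        iteratedDeriv (k - 1 - 1 - 1) (fun t => (quarticSqrt t)⁻¹) 0))) := by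
  set h : ℂ → ℂ := fun t => (quarticSqrt t)⁻¹ with hh
  have hS : quarticSqrt 0 ≠ 0 := by simp [quarticSqrt_zero]
  have ha : AnalyticAt ℂ h 0 := analyticAt_quarticSqrt.inv hS
  have ha' := ha.deriv
  have hode : deriv h =ᶠ[𝓝 0] fun t => 3 * (t * (t * deriv h t))
      - 3 * (t * (t * (t * (t * deriv h t)))) + 3 * (t * h t) - 6 * (t * (t * (t * h t))) := by
    filter_upwards [ball_half_mem_nhds] with t ht
    have h0 := quarticSqrt_ne_zero ht
    have hd : deriv h t = _ := ((hasDerivAt_quarticSqrt ht).inv h0).deriv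
    have hsq := quarticSqrt_sq t
    rw [hd]
    simp only [hh]
    field_simp
    linear_combination (6 * t ^ 3 - 3 * t) * hsq
  rw [iteratedDeriv_succ', hode.iteratedDeriv_eq]
  rw [iteratedDeriv_fun_sub, iteratedDeriv_fun_add, iteratedDeriv_fun_sub,
    iteratedDeriv_const_mul_field, iteratedDeriv_const_mul_field, iteratedDeriv_const_mul_field,
    iteratedDeriv_const_mul_field]
  · rw [iteratedDeriv_id_mul_zero (g := fun t => t * deriv h t) (by fun_prop),
      iteratedDeriv_id_mul_zero (g := fun t => deriv h t) (by fun_prop),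
      iteratedDeriv_id_mul_zero (g := fun t => t * (t * (t * deriv h t))) (by fun_prop),
      iteratedDeriv_id_mul_zero (g := fun t => t * (t * deriv h t)) (by fun_prop),
      iteratedDeriv_id_mul_zero (g := fun t => t * deriv h t) (by fun_prop),
      iteratedDeriv_id_mul_zero (g := fun t => deriv h t) (by fun_prop),
      iteratedDeriv_id_mul_zero (g := fun t => h t) (by fun_prop),
      iteratedDeriv_id_mul_zero (g := fun t => t * (t * h t)) (by fun_prop),
      iteratedDeriv_id_mul_zero (g := fun t => t * h t) (by fun_prop),
      iteratedDeriv_id_mul_zero (g := fun t => h t) (by fun_prop)]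
    simp only [iteratedDeriv_succ']
  all_goals exact AnalyticAt.contDiffAt (by fun_prop)

theorem egfCoeffs_ellipticJ :
    EgfCoeffsStartWith ellipticJ [0, 1, 0, 3, 0, 45, 0, 1215, 0, 8505] := by
  have hJ : deriv ellipticJ =ᶠ[𝓝 0] fun t => (quarticSqrt t)⁻¹ := by
    filter_upwards [ball_half_mem_nhds] with t ht
    exact (hasDerivAt_ellipticJ ht).deriv
  have hs (k : ℕ) : iteratedDeriv (k + 1) ellipticJ 0 =
      iteratedDeriv k (fun t => (quarticSqrt t)⁻¹) 0 := by
    rw [iteratedDeriv_succ', hJ.iteratedDeriv_eq]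
  have hr := iteratedDeriv_inv_quarticSqrt
  obtain ⟨a, ha⟩ : ∃ a : ℕ → ℂ, ∀ k, iteratedDeriv k (fun t => (quarticSqrt t)⁻¹) 0 = a k :=
    ⟨_, fun _ => rfl⟩
  have a0 : a 0 = 1 := by simp [← ha, quarticSqrt_zero]
  simp only [ha] at hr hs
  have a1 : a 1 = 0 := by simpa using hr 0
  have a2 : a 2 = 3 := by simpa [a0, a1] using hr 1
  have a3 : a 3 = 0 := by simpa [a0, a1, a2] using hr 2
  have a4 : a 4 = 45 := by have := hr 3; norm_num [a0, a1, a2, a3] at this; exact this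
  have a5 : a 5 = 0 := by have := hr 4; norm_num [a0, a1, a2, a3, a4] at this; exact this
  have a6 : a 6 = 1215 := by have := hr 5; norm_num [a0, a1, a2, a3, a4, a5] at this; exact this
  have a7 : a 7 = 0 := by have := hr 6; norm_num [a0, a1, a2, a3, a4, a5, a6] at this; exact this
  have a8 : a 8 = 8505 := by
    have := hr 7; norm_num [a0, a1, a2, a3, a4, a5, a6, a7] at this; exact this
  intro k hk
  simp only [List.length_cons, List.length_nil] at hk
  interval_cases k
  · simpa using ellipticJ_zero
  all_goals rw [hs]
  exacts [a0, a1, a2, a3, a4, a5, a6, a7, a8]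

/-! ### The uniformizing parameter of the cubic curve near `t = 0` -/

/-- The function t(w) has derivative 1 at 0, so the inverse function theorem applies. -/
theorem exists_uniformizer : ∃ w : ℂ → ℂ, AnalyticAt ℂ w 0 ∧ w 0 = 0 ∧
    ∀ᶠ t in 𝓝 (0 : ℂ), (w t ^ 2 + 3) * w t / (3 * (w t ^ 2 + 1)) = t := by
  set f : ℂ → ℂ := fun w => (w ^ 2 + 3) * w / (3 * (w ^ 2 + 1)) with hf
  have hfa : AnalyticAt ℂ f 0 := by
    refine AnalyticAt.div (by fun_prop) (by fun_prop) (by simp)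
  have h1 : HasDerivAt (fun w : ℂ => (w ^ 2 + 3) * w) 3 0 := by
    have := ((hasDerivAt_pow 2 (0 : ℂ)).add_const 3).mul (hasDerivAt_id (0 : ℂ))
    exact this.congr_deriv (by simp)
  have h2 : HasDerivAt (fun w : ℂ => 3 * (w ^ 2 + 1)) 0 0 := by
    have := ((hasDerivAt_pow 2 (0 : ℂ)).add_const 1).const_mul 3
    exact this.congr_deriv (by simp)
  have hd : deriv f 0 = 1 := by
    have := (h1.div h2 (by simp)).deriv
    refine this.trans ?_
    norm_num
  have hd0 : deriv f 0 ≠ 0 := by simp [hd]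
  have hf0 : f 0 = 0 := by simp [hf]
  have hst := hfa.hasStrictDerivAt
  refine ⟨hst.localInverse f _ 0 hd0, ?_, ?_, ?_⟩
  · have := hfa.analyticAt_localInverse hd0
    rwa [hf0] at this
  · have := (hst.hasStrictFDerivAt_equiv hd0).localInverse_apply_image
    rwa [hf0] at this
  · have := (hst.hasStrictFDerivAt_equiv hd0).eventually_right_inverse
    rwa [hf0] at this

/-- The even part `3(w² + 1)/(w⁴ + 3)` of the branch, in terms of the parameter. -/
noncomputable def etaEven (w : ℂ) : ℂ := 3 * (w ^ 2 + 1) / (w ^ 4 + 3)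

/-- The odd part of the branch, in terms of the parameter. -/
noncomputable def etaOdd (w : ℂ) : ℂ := w * etaEven w

/-- The even part of `χ`. -/
noncomputable def chiEven (w t : ℂ) : ℂ :=
  (t * etaOdd w + (1 - 3 * t ^ 2) * etaEven w) / quarticSqrt t

/-- The odd part of `χ`. -/
noncomputable def chiOdd (w t : ℂ) : ℂ :=
  ((1 - t ^ 2) * etaOdd w - t * etaEven w) / quarticSqrt t

theorem eta_mem_curve {w t : ℂ} (h1 : w ^ 2 + 1 ≠ 0) (h2 : w ^ 4 + 3 ≠ 0)
    (ht : (w ^ 2 + 3) * w / (3 * (w ^ 2 + 1)) = t) :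
    MvPolynomial.eval ![t, etaEven w + etaOdd w] etaCurve = 0 := by
  simp only [etaCurve, map_add, map_sub, map_mul, map_pow, map_ofNat, map_one,
    MvPolynomial.eval_X, Matrix.cons_val_zero, Matrix.cons_val_one, etaEven, etaOdd, ← ht]
  field_simp
  ring

/-- After substitution of t(w) and clearing of S² = P this is a rational identity in `w`. The sign
of the root is settled separately, near t = 0. -/
theorem chi_sq {w t : ℂ} (h1 : w ^ 2 + 1 ≠ 0) (h2 : w ^ 4 + 3 ≠ 0)
    (ht : (w ^ 2 + 3) * w / (3 * (w ^ 2 + 1)) = t) (hS : quarticSqrt t ≠ 0) :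
    (chiEven w t + chiOdd w t) ^ 2 =
      (etaEven w + etaOdd w) ^ 2 - 2 * t * (1 + t) / (1 - 3 * t ^ 2 + 3 * t ^ 4) := by
  have hP : 1 - 3 * t ^ 2 + 3 * t ^ 4 ≠ 0 := by
    rw [← quarticSqrt_sq]
    exact pow_ne_zero _ hS
  have key : (t * etaOdd w + (1 - 3 * t ^ 2) * etaEven w + ((1 - t ^ 2) * etaOdd w - t * etaEven w))
      ^ 2 = (1 - 3 * t ^ 2 + 3 * t ^ 4) * (etaEven w + etaOdd w) ^ 2 - 2 * t * (1 + t) := by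
    simp only [etaEven, etaOdd, ← ht]
    field_simp
    ring
  rw [chiEven, chiOdd, ← add_div, div_pow, quarticSqrt_sq, key]
  field_simp

/-- Inverse of dt/dw = (w⁴ + 3) / (3(w² + 1)²). -/
theorem hasDerivAt_uniformizer {w : ℂ → ℂ} {t : ℂ} (hw : AnalyticAt ℂ w t)
    (h1 : w t ^ 2 + 1 ≠ 0) (h2 : w t ^ 4 + 3 ≠ 0)
    (ht : ∀ᶠ s in 𝓝 t, (w s ^ 2 + 3) * w s / (3 * (w s ^ 2 + 1)) = s) :
    HasDerivAt w (3 * (w t ^ 2 + 1) ^ 2 / (w t ^ 4 + 3)) t := by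
  have hd := hw.differentiableAt.hasDerivAt
  have ha := ((hd.pow 2).add_const 3).mul hd
  have hb := ((hd.pow 2).add_const 1).const_mul 3
  have hc := (ha.div hb (by simpa using h1)).congr_of_eventuallyEq
    (f₁ := fun s => s) (by filter_upwards [ht] with s hs using hs.symm)
  have := hc.unique (hasDerivAt_id t)
  refine hd.congr_deriv ?_
  simp at this
  field_simp at this ⊢
  linear_combination this

theorem hasDerivAt_etaEven {w : ℂ} (h2 : w ^ 4 + 3 ≠ 0) :
    HasDerivAt etaEven ((6 * w * (w ^ 4 + 3) - 12 * w ^ 3 * (w ^ 2 + 1)) / (w ^ 4 + 3) ^ 2) w := by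
  have ha := ((hasDerivAt_pow 2 w).add_const 1).const_mul 3
  have hb := (hasDerivAt_pow 4 w).add_const 3
  refine (ha.div hb h2).congr_deriv ?_
  congr 1
  norm_num
  ring

/-- The even and odd parts of the branch solve the differential system at `z = 0`. -/
theorem hasDerivAt_eta_system {w : ℂ → ℂ} {t : ℂ} (hw : AnalyticAt ℂ w t)
    (h1 : w t ^ 2 + 1 ≠ 0) (h2 : w t ^ 4 + 3 ≠ 0)
    (ht : ∀ᶠ s in 𝓝 t, (w s ^ 2 + 3) * w s / (3 * (w s ^ 2 + 1)) = s) :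
    ∃ e' o' : ℂ, HasDerivAt (fun s => etaEven (w s)) e' t ∧
      HasDerivAt (fun s => etaOdd (w s)) o' t ∧
      (1 - t ^ 2) * o' - t * e' = etaEven (w t) + t * etaOdd (w t) ∧
      t * o' + (1 - 3 * t ^ 2) * e' = 3 * t * etaEven (w t) := by
  have hd := hasDerivAt_uniformizer hw h1 h2 ht
  have he := (hasDerivAt_etaEven h2).comp t hd
  have ho := hd.mul he
  refine ⟨_, _, he, ho, ?_, ?_⟩
  · have ht' := ht.self_of_nhds
    simp only [etaOdd, etaEven, Function.comp]
    generalize w t = v at *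
    rw [← ht']
    field_simp
    ring
  · have ht' := ht.self_of_nhds
    simp only [etaEven, Function.comp]
    generalize w t = v at *
    rw [← ht']
    field_simp
    ring

/-! ### From the system at z = 0 to all z -/

theorem hasDerivAt_chi_system {e o : ℂ → ℂ} {t e' o' : ℂ} (hb : t ∈ Metric.ball (0 : ℂ) (1 / 2))
    (he : HasDerivAt e e' t) (ho : HasDerivAt o o' t)
    (h1 : (1 - t ^ 2) * o' - t * e' = e t + t * o t)
    (h2 : t * o' + (1 - 3 * t ^ 2) * e' = 3 * t * e t) :
    ∃ x' y' : ℂ,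
      HasDerivAt (fun s => (s * o s + (1 - 3 * s ^ 2) * e s) / quarticSqrt s) x' t ∧
      HasDerivAt (fun s => ((1 - s ^ 2) * o s - s * e s) / quarticSqrt s) y' t ∧
      (1 - t ^ 2) * x' - t * y' = ((1 - t ^ 2) * o t - t * e t) / quarticSqrt t
        + t * ((t * o t + (1 - 3 * t ^ 2) * e t) / quarticSqrt t) ∧
      t * x' + (1 - 3 * t ^ 2) * y' = 3 * t * (((1 - t ^ 2) * o t - t * e t) / quarticSqrt t) := by
  have hS := quarticSqrt_ne_zero hb
  have hsq := quarticSqrt_sq t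
  have hSd := hasDerivAt_quarticSqrt hb
  have hid := hasDerivAt_id t
  -- The numerators are the left-hand sides of the system with o, e in place of o', e', so the
  -- system itself eliminates o' and e' from their derivatives.
  have hn1 : HasDerivAt (fun s => s * o s + (1 - 3 * s ^ 2) * e s) (o t - 3 * t * e t) t := by
    have := (hid.mul ho).add ((((hid.pow 2).const_mul 3).const_sub 1).mul he)
    refine this.congr_deriv ?_
    simp
    linear_combination h2
  have hn2 : HasDerivAt (fun s => (1 - s ^ 2) * o s - s * e s) (-(t * o t)) t := by
    have := (((hid.pow 2).const_sub 1).mul ho).sub (hid.mul he)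
    refine this.congr_deriv ?_
    simp
    linear_combination h1
  refine ⟨_, _, hn1.div hSd hS, hn2.div hSd hS, ?_, ?_⟩
  · field_simp
    rw [hsq]
    ring
  · field_simp
    rw [hsq]
    ring

/-- The terms from differentiating e, o, x, y cancel by the system at z = 0. Those from
differentiating zJ carry z/S, and the involution exchanging (o, e) and (x, y) turns them into z
times the unknowns in exchanged places. -/
theorem hasDerivAt_hyperbolic_system {e o x y : ℂ → ℂ} {t e' o' x' y' : ℂ} (z : ℂ)
    (hb : t ∈ Metric.ball (0 : ℂ) (1 / 2))
    (he : HasDerivAt e e' t) (ho : HasDerivAt o o' t) (hx : HasDerivAt x x' t)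
    (hy : HasDerivAt y y' t)
    (hxt : x t = (t * o t + (1 - 3 * t ^ 2) * e t) / quarticSqrt t)
    (hyt : y t = ((1 - t ^ 2) * o t - t * e t) / quarticSqrt t)
    (h1 : (1 - t ^ 2) * o' - t * e' = e t + t * o t)
    (h2 : t * o' + (1 - 3 * t ^ 2) * e' = 3 * t * e t)
    (h3 : (1 - t ^ 2) * x' - t * y' = y t + t * x t)
    (h4 : t * x' + (1 - 3 * t ^ 2) * y' = 3 * t * y t) :
    ∃ E' O' : ℂ,
      HasDerivAt (fun s => e s * Complex.cosh (z * ellipticJ s)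
        + y s * Complex.sinh (z * ellipticJ s)) E' t ∧
      HasDerivAt (fun s => o s * Complex.cosh (z * ellipticJ s)
        + x s * Complex.sinh (z * ellipticJ s)) O' t ∧
      O' = z * (e t * Complex.cosh (z * ellipticJ t) + y t * Complex.sinh (z * ellipticJ t)) + t * E'
        + (e t * Complex.cosh (z * ellipticJ t) + y t * Complex.sinh (z * ellipticJ t))
        + t * (o t * Complex.cosh (z * ellipticJ t) + x t * Complex.sinh (z * ellipticJ t))
        + t * (t * O') ∧
      E' = z * (o t * Complex.cosh (z * ellipticJ t) + x t * Complex.sinh (z * ellipticJ t)) - t * O'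
        + 3 * (t * (e t * Complex.cosh (z * ellipticJ t) + y t * Complex.sinh (z * ellipticJ t)))
        + 3 * (t * (t * E')) := by
  have hS := quarticSqrt_ne_zero hb
  have hsq := quarticSqrt_sq t
  have hJ := (hasDerivAt_ellipticJ hb).const_mul z
  refine ⟨_, _, (he.mul hJ.ccosh).add (hy.mul hJ.csinh), (ho.mul hJ.ccosh).add (hx.mul hJ.csinh),
    ?_, ?_⟩
  · have q1 : (1 - t ^ 2) * o t - t * e t = quarticSqrt t * y t := by rw [hyt]; field_simp
    -- The involution applied twice: here S² = P cancels the determinant.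
    have q2 : (1 - t ^ 2) * x t - t * y t = quarticSqrt t * e t := by
      rw [hxt, hyt]
      field_simp
      rw [hsq]
      ring
    have r1 : (quarticSqrt t)⁻¹ * ((1 - t ^ 2) * o t - t * e t) = y t := by rw [q1]; field_simp
    have r2 : (quarticSqrt t)⁻¹ * ((1 - t ^ 2) * x t - t * y t) = e t := by rw [q2]; field_simp
    linear_combination Complex.cosh (z * ellipticJ t) * h1 + Complex.sinh (z * ellipticJ t) * h3
      + z * Complex.sinh (z * ellipticJ t) * r1 + z * Complex.cosh (z * ellipticJ t) * r2
  · have q1 : t * o t + (1 - 3 * t ^ 2) * e t = quarticSqrt t * x t := by rw [hxt]; field_simp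
    have q2 : t * x t + (1 - 3 * t ^ 2) * y t = quarticSqrt t * o t := by
      rw [hxt, hyt]
      field_simp
      rw [hsq]
      ring
    have r1 : (quarticSqrt t)⁻¹ * (t * o t + (1 - 3 * t ^ 2) * e t) = x t := by rw [q1]; field_simp
    have r2 : (quarticSqrt t)⁻¹ * (t * x t + (1 - 3 * t ^ 2) * y t) = o t := by rw [q2]; field_simp
    linear_combination Complex.cosh (z * ellipticJ t) * h2 + Complex.sinh (z * ellipticJ t) * h4
      + z * Complex.sinh (z * ellipticJ t) * r1 + z * Complex.cosh (z * ellipticJ t) * r2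

/-- The local solution data: on a ball around `0` the parameter `w` is regular. -/
theorem exists_uniformizer_on_ball : ∃ w : ℂ → ℂ, w 0 = 0 ∧ ∃ r > 0, r ≤ 1 / 2 ∧
    ∀ t ∈ Metric.ball (0 : ℂ) r, AnalyticAt ℂ w t ∧ w t ^ 2 + 1 ≠ 0 ∧ w t ^ 4 + 3 ≠ 0 ∧
      ∀ᶠ s in 𝓝 t, (w s ^ 2 + 3) * w s / (3 * (w s ^ 2 + 1)) = s := by
  obtain ⟨w, hw, hw0, hwt⟩ := exists_uniformizer
  have hc := hw.continuousAt
  have e1 : ∀ᶠ t in 𝓝 (0 : ℂ), w t ^ 2 + 1 ≠ 0 :=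
    ((hc.pow 2).add continuousAt_const).eventually_ne (by simp [hw0])
  have e2 : ∀ᶠ t in 𝓝 (0 : ℂ), w t ^ 4 + 3 ≠ 0 :=
    ((hc.pow 4).add continuousAt_const).eventually_ne (by simp [hw0])
  obtain ⟨r, hr, h⟩ := Metric.eventually_nhds_iff_ball.mp
    (hw.eventually_analyticAt.and (e1.and (e2.and hwt.eventually_nhds)))
  -- The cap 1/2 keeps the ball where S is holomorphic and nonzero.
  exact ⟨w, hw0, min r (1 / 2), by positivity, min_le_right _ _,
    fun t ht => h t (Metric.ball_subset_ball (min_le_left _ _) ht)⟩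

/-- `E` and `O` solve the differential system satisfied by the even and odd parts of the generating
function on the ball of radius `r`. -/
def SolvesSystem (z : ℂ) (r : ℝ) (E O : ℂ → ℂ) : Prop :=
  ∀ t ∈ Metric.ball (0 : ℂ) r, ∃ E' O' : ℂ, HasDerivAt E E' t ∧ HasDerivAt O O' t ∧
    O' = z * E t + t * E' + E t + t * O t + t * (t * O') ∧
    E' = z * O t - t * O' + 3 * (t * E t) + 3 * (t * (t * E'))

namespace SolvesSystem

variable {z : ℂ} {r : ℝ} {E O : ℂ → ℂ}

theorem differentiableOn (h : SolvesSystem z r E O) :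
    DifferentiableOn ℂ E (Metric.ball 0 r) ∧ DifferentiableOn ℂ O (Metric.ball 0 r) := by
  constructor <;> intro t ht <;> obtain ⟨E', O', hE, hO, -⟩ := h t ht
  exacts [hE.differentiableAt.differentiableWithinAt, hO.differentiableAt.differentiableWithinAt]

theorem analyticAt (h : SolvesSystem z r E O) (hr : 0 < r) :
    AnalyticAt ℂ E 0 ∧ AnalyticAt ℂ O 0 :=
  ⟨h.differentiableOn.1.analyticAt (Metric.ball_mem_nhds _ hr),
    h.differentiableOn.2.analyticAt (Metric.ball_mem_nhds _ hr)⟩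

theorem deriv_eventuallyEq (h : SolvesSystem z r E O) (hr : 0 < r) :
    (deriv O =ᶠ[𝓝 0] fun t => z * E t + t * deriv E t + E t + t * O t + t * (t * deriv O t)) ∧
    (deriv E =ᶠ[𝓝 0] fun t => z * O t - t * deriv O t + 3 * (t * E t)
      + 3 * (t * (t * deriv E t))) := by
  constructor <;> filter_upwards [Metric.ball_mem_nhds (0 : ℂ) hr] with t ht <;>
    obtain ⟨E', O', hE, hO, h1, h2⟩ := h t ht <;> rw [hE.deriv, hO.deriv] <;> assumption

theorem iteratedDeriv_add_eq_recipDenom (h : SolvesSystem z r E O) (hr : 0 < r) (hE0 : E 0 = 1)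
    (hO0 : O 0 = 0) (k : ℕ) :
    iteratedDeriv k (fun t => E t + O t) 0 = (recipDenom k).eval z := by
  obtain ⟨hE, hO⟩ := h.analyticAt hr
  obtain ⟨h1, h2⟩ := h.deriv_eventuallyEq hr
  obtain ⟨a, b⟩ := iteratedDeriv_system_eq_recipDenom hE hO h1 h2 hE0 hO0 k
  rw [iteratedDeriv_fun_add hE.contDiffAt hO.contDiffAt, a, b]
  ring

/-- A function holomorphic on a ball is the sum of its Taylor series on all of it, so the radius of
the system is a radius of convergence valid for `Υ`. -/
theorem hasSum (h : SolvesSystem z r E O) (hE0 : E 0 = 1) (hO0 : O 0 = 0) {t : ℂ}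
    (ht : t ∈ Metric.ball (0 : ℂ) r) :
    HasSum (fun k : ℕ => (recipDenom k).eval z * (t ^ k / (k.factorial : ℂ))) (E t + O t) := by
  have hr : 0 < r := Metric.pos_of_mem_ball ht
  have := Complex.hasSum_taylorSeries_on_ball
    (h.differentiableOn.1.add h.differentiableOn.2) ht
  refine (funext fun k => ?_ : (fun k : ℕ => _) = _) ▸ this
  have e : iteratedDeriv k (E + O) 0 = (recipDenom k).eval z :=
    h.iteratedDeriv_add_eq_recipDenom hr hE0 hO0 k
  simp only [e, sub_zero, smul_eq_mul]
  ring

end SolvesSystem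

/-- The even and odd parts `e`, `o` of the branch and `x`, `y` of `χ`, near `0`. -/
theorem exists_local_solution : ∃ e o x y : ℂ → ℂ, ∃ r > 0,
    e 0 = 1 ∧ o 0 = 0 ∧ x 0 = 1 ∧ y 0 = 0 ∧
    (∀ t ∈ Metric.ball (0 : ℂ) r, MvPolynomial.eval ![t, e t + o t] etaCurve = 0 ∧
      (x t + y t) ^ 2 = (e t + o t) ^ 2 - 2 * t * (1 + t) / (1 - 3 * t ^ 2 + 3 * t ^ 4)) ∧
    SolvesSystem 0 r e o ∧ SolvesSystem 0 r y x ∧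
    ∀ z : ℂ, SolvesSystem z r
      (fun s => e s * Complex.cosh (z * ellipticJ s) + y s * Complex.sinh (z * ellipticJ s))
      (fun s => o s * Complex.cosh (z * ellipticJ s) + x s * Complex.sinh (z * ellipticJ s)) := by
  obtain ⟨w, hw0, r, hr, hr2, hw⟩ := exists_uniformizer_on_ball
  refine ⟨fun t => etaEven (w t), fun t => etaOdd (w t), fun t => chiEven (w t) t,
    fun t => chiOdd (w t) t, r, hr, ?_, ?_, ?_, ?_, fun t ht => ?_, fun t ht => ?_, fun t ht => ?_,
    fun z t ht => ?_⟩
  · simp [hw0, etaEven]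
  · simp [hw0, etaOdd]
  · simp [hw0, chiEven, etaEven, quarticSqrt_zero]
  · simp [hw0, chiOdd, etaOdd]
  all_goals
    obtain ⟨hwa, h1, h2, hwt⟩ := hw t ht
    have hb := Metric.ball_subset_ball hr2 ht
  · exact ⟨eta_mem_curve h1 h2 hwt.self_of_nhds,
      chi_sq h1 h2 hwt.self_of_nhds (quarticSqrt_ne_zero hb)⟩
  all_goals obtain ⟨e', o', he, ho, q1, q2⟩ := hasDerivAt_eta_system hwa h1 h2 hwt
  · exact ⟨e', o', he, ho, by linear_combination q1, by linear_combination q2⟩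
  all_goals obtain ⟨x', y', hx, hy, q3, q4⟩ := hasDerivAt_chi_system hb he ho q1 q2
  -- The slots are exchanged: the odd function y takes the place of `E`, the even function x that of
  -- `O`.
  · refine ⟨y', x', hy, hx, ?_, ?_⟩
    · simp only [chiEven, chiOdd]
      linear_combination q3
    · simp only [chiEven, chiOdd]
      linear_combination q4
  · exact hasDerivAt_hyperbolic_system z hb he ho hx hy rfl rfl q1 q2 q3 q4

/-! ### Uniqueness of the branch, expansions and conclusion -/

/-- The difference of the two equations is η - η' times a factor equal to -6 at t = 0, hence nonzero
nearby: η = 1 is a simple root there. -/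
theorem isEtaBranch_unique {η η' : ℂ → ℂ} (h : IsEtaBranch η) (h' : IsEtaBranch η') :
    η =ᶠ[𝓝 0] η' := by
  obtain ⟨ha, h0, hc⟩ := h
  obtain ⟨ha', h0', hc'⟩ := h'
  have hcont : ContinuousAt (fun t : ℂ => 3 * t * (1 + t) -
      2 * (1 - 3 * t ^ 2 + 3 * t ^ 4) * (η t ^ 2 + η t * η' t + η' t ^ 2)) 0 := by
    have := ha.continuousAt
    have := ha'.continuousAt
    fun_prop
  have hne := hcont.eventually_ne (y := 0) (by norm_num [h0, h0'])
  filter_upwards [hc, hc', hne] with t ht ht' hn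
  simp only [etaCurve, map_add, map_sub, map_mul, map_pow, map_ofNat, map_one,
      MvPolynomial.eval_X, Matrix.cons_val_zero, Matrix.cons_val_one] at ht ht'
  have : (η t - η' t) * (3 * t * (1 + t) -
      2 * (1 - 3 * t ^ 2 + 3 * t ^ 4) * (η t ^ 2 + η t * η' t + η' t ^ 2)) = 0 := by
    linear_combination ht - ht'
  exact sub_eq_zero.mp ((mul_eq_zero.mp this).resolve_right hn)

/-- The coefficients of η are the numbers `q_k(0)`, computed by the recurrence. -/
theorem egfCoeffs_eta {e o : ℂ → ℂ} {r : ℝ} (hr : 0 < r) (h : SolvesSystem 0 r e o)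
    (he : e 0 = 1) (ho : o 0 = 0) :
    EgfCoeffsStartWith (fun t => e t + o t) [1, 1, 2, 10, 24, 280, 400, 12880] := by
  have hs := h.iteratedDeriv_add_eq_recipDenom hr he ho
  obtain ⟨q, hq⟩ : ∃ q : ℕ → ℂ, ∀ k, (recipDenom k).eval 0 = q k := ⟨_, fun _ => rfl⟩
  have hrec := fun k => eval_recipDenom_add_two k 0
  have q0 : q 0 = 1 := by simp [← hq, recipDenom_zero]
  have q1 : q 1 = 1 := by simp [← hq, recipDenom_one]
  simp only [hq, jCoeffC, jCoeffA] at hrec hs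
  have q2 : q 2 = 2 := by have := hrec 0; norm_num [q0, q1] at this; exact this
  have q3 : q 3 = 10 := by have := hrec 1; norm_num [q1, q2] at this; exact this
  have q4 : q 4 = 24 := by have := hrec 2; norm_num [q2, q3] at this; exact this
  have q5 : q 5 = 280 := by have := hrec 3; norm_num [q3, q4] at this; exact this
  have q6 : q 6 = 400 := by have := hrec 4; norm_num [q4, q5] at this; exact this
  have q7 : q 7 = 12880 := by have := hrec 5; norm_num [q5, q6] at this; exact this
  intro k hk
  simp only [List.length_cons, List.length_nil] at hk
  rw [hs]
  interval_cases k
  exacts [q0, q1, q2, q3, q4, q5, q6, q7]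

/-- Same system at z = 0, but with initial values 0 for y and 1 for x, so the coefficients are no
longer the `q_k(0)`. -/
theorem egfCoeffs_chi {x y : ℂ → ℂ} {r : ℝ} (hr : 0 < r) (h : SolvesSystem 0 r y x)
    (hx : x 0 = 1) (hy : y 0 = 0) :
    EgfCoeffsStartWith (fun t => x t + y t) [1, 0, 1, -2, 1, -100, -575] := by
  obtain ⟨hya, hxa⟩ := h.analyticAt hr
  obtain ⟨h1, h2⟩ := h.deriv_eventuallyEq hr
  have hs := iteratedDeriv_system hya hxa h1 h2
  obtain ⟨a, ha⟩ : ∃ a : ℕ → ℂ, ∀ k, iteratedDeriv k x 0 = a k := ⟨_, fun _ => rfl⟩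
  obtain ⟨b, hb⟩ : ∃ b : ℕ → ℂ, ∀ k, iteratedDeriv k y 0 = b k := ⟨_, fun _ => rfl⟩
  have a0 : a 0 = 1 := by simp [← ha, hx]
  have b0 : b 0 = 0 := by simp [← hb, hy]
  simp only [ha, hb] at hs
  have s1 : a 1 = 0 ∧ b 1 = 0 := by have := hs 0; norm_num [a0, b0] at this; exact this
  have s2 : a 2 = 1 ∧ b 2 = 0 := by have := hs 1; norm_num [a0, b0, s1] at this; exact this
  have s3 : a 3 = 0 ∧ b 3 = -2 := by have := hs 2; norm_num [s1, s2] at this; exact this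
  have s4 : a 4 = 1 ∧ b 4 = 0 := by have := hs 3; norm_num [s2, s3] at this; exact this
  have s5 : a 5 = 0 ∧ b 5 = -100 := by have := hs 4; norm_num [s3, s4] at this; exact this
  have s6 : a 6 = -575 ∧ b 6 = 0 := by have := hs 5; norm_num [s4, s5] at this; exact this
  intro k hk
  simp only [List.length_cons, List.length_nil] at hk
  rw [iteratedDeriv_fun_add hxa.contDiffAt hya.contDiffAt, ha, hb]
  interval_cases k <;> simp [a0, b0, s1, s2, s3, s4, s5, s6]

theorem EgfCoeffsStartWith.congr {f g : ℂ → ℂ} {l : List ℂ} (hf : EgfCoeffsStartWith f l)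
    (h : g =ᶠ[𝓝 0] f) : EgfCoeffsStartWith g l :=
  fun k hk => h.iteratedDeriv_eq k ▸ hf k hk

theorem theorem8 :
    -- the cubic curve has genus `0` and is parametrized by the given rational functions of `w`
    PlaneCurveHasGenus etaCurve 0 ∧
    IsRationalParametrization etaCurve
      (1 / 3 * (((RatFunc.X ^ 2 + 3) * RatFunc.X) / (RatFunc.X ^ 2 + 1)))
      (3 * (((RatFunc.X + 1) * (RatFunc.X ^ 2 + 1)) / (RatFunc.X ^ 4 + 3))) ∧
    -- there is exactly one germ of a branch `η` with `η(0) = 1`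
    (∃ η : ℂ → ℂ, IsEtaBranch η) ∧
    (∀ η η' : ℂ → ℂ, IsEtaBranch η → IsEtaBranch η' → η =ᶠ[𝓝 0] η') ∧
    ∀ η : ℂ → ℂ, IsEtaBranch η →
      -- the displayed expansions at `t = 0`
      EgfCoeffsStartWith η [1, 1, 2, 10, 24, 280, 400, 12880] ∧
      AnalyticAt ℂ (chiOf η) 0 ∧
      EgfCoeffsStartWith (chiOf η) [1, 0, 1, -2, 1, -100, -575] ∧
      AnalyticAt ℂ ellipticJ 0 ∧
      EgfCoeffsStartWith ellipticJ [0, 1, 0, 3, 0, 45, 0, 1215, 0, 8505] ∧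
      -- the generating function, for `t` in a neighbourhood of `0` that does not depend on `z`
      ∀ᶠ t in 𝓝 (0 : ℂ), ∀ z : ℂ,
        HasSum (fun k : ℕ => (recipDenom k).eval z * (t ^ k / (k.factorial : ℂ)))
          (η t * Complex.cosh (z * ellipticJ t) + chiOf η t * Complex.sinh (z * ellipticJ t)) := by
  refine ⟨planeCurveHasGenus_etaCurve, isFunctionFieldOf_param, ?_,
    fun _ _ => isEtaBranch_unique, ?_⟩
  all_goals obtain ⟨e, o, x, y, r, hr, e0, o0, x0, y0, hcurve, heo, hyx, hz⟩ := exists_local_solution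
  all_goals
    obtain ⟨hea, hoa⟩ := heo.analyticAt hr
    have hbranch : IsEtaBranch (fun t => e t + o t) :=
      ⟨hea.add hoa, by simp [e0, o0], Filter.eventually_of_mem (Metric.ball_mem_nhds _ hr)
        fun t ht => (hcurve t ht).1⟩
  · exact ⟨_, hbranch⟩
  · intro η hη
    have heq := isEtaBranch_unique hη hbranch
    obtain ⟨hya, hxa⟩ := hyx.analyticAt hr
    have hxya : AnalyticAt ℂ (fun t => x t + y t) 0 := hxa.add hya
    -- Positive real part singles out x + y as the principal root of its square.
    have hre : ∀ᶠ t in 𝓝 (0 : ℂ), 0 < (x t + y t).re := by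
      have : ContinuousAt (fun t => (x t + y t).re) 0 :=
        Complex.continuous_re.continuousAt.comp hxya.continuousAt
      exact continuousAt_const.eventually_lt this (by simp [x0, y0])
    have hchi : chiOf η =ᶠ[𝓝 0] fun t => x t + y t := by
      filter_upwards [heq, hre, Metric.ball_mem_nhds (0 : ℂ) hr] with t ht hpos hb
      rw [chiOf, ht, ← (hcurve t hb).2, one_div, Complex.sq_cpow_two_inv hpos]
    refine ⟨(egfCoeffs_eta hr heo e0 o0).congr heq, hxya.congr hchi.symm,
      (egfCoeffs_chi hr hyx x0 y0).congr hchi, analyticAt_ellipticJ, egfCoeffs_ellipticJ, ?_⟩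
    filter_upwards [heq, hchi, Metric.ball_mem_nhds (0 : ℂ) hr] with t ht hc hb z
    have := (hz z).hasSum (by simp [e0, y0, ellipticJ_zero]) (by simp [o0, x0, ellipticJ_zero]) hb
    rw [ht, hc]
    convert this using 1
    ring
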